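/- Work in $\mathrm{ZFC}$. For a cardinal $\theta$, $H(\theta)$ is the set of all $x$ whose transitive closure has cardinality $<\theta$; for a set $X$ and an infinite cardinal $\kappa$, $\mathscr P_\kappa X=\{x\subseteq X : |x|<\kappa\}$. For $\kappa$ regular uncountable, a set $C\subseteq\mathscr P_\kappa X$ is a club if it is $\subseteq$-cofinal in $\mathscr P_\kappa X$ and $\bigcup D\in C$ for every nonempty $D\subseteq C$ with $|D|<\kappa$ that is linearly ordered by $\subseteq$; $S\subseteq\mathscr P_\kappa X$ is stationary if it meets every club in $\mathscr P_\kappa X$. A $(\kappa,X)$-list is a sequence $\langle d_x : x\in\mathscr P_\kappa X\rangle$ with $d_x\subseteq x$ for all $x$. It is $\mu$-slender if for all sufficiently large cardinals $\theta$ there is a club $C\subseteq\mathscr P_\kappa H(\theta)$ such that $d_{M\cap X}\cap y\in M$ for all $M\in C$ and all $y\in M\cap\mathscr P_\mu X$. A cofinal branch of the list is a set $d\subseteq X$ such that for every $x\in\mathscr P_\kappa X$ there is $z\in\mathscr P_\kappa X$ with $z\supseteq x$ and $d\cap x=d_z\cap x$. The principle $\mathsf{SP}(\mu,\kappa,X)$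 says that every $\mu$-slender $(\kappa,X)$-list has a cofinal branch. Let $M\prec (H(\theta),\in)$, $x\in M$ and $d\subseteq x$. The set $d$ is $(\mu,M)$-approximated if for every $z\in M\cap\mathscr P_\mu(x)$ there is $e\in M$ with $d\cap z=e\cap z$; it is $M$-guessed if there is $e\in M$ with $d\cap M=e\cap M$. $M$ is a $\mu$-guessing model for $x$ if every $(\mu,M)$-approximated $d\subseteq x$ is $M$-guessed, and a $\mu$-guessing model if this holds for every $x\in M$. $M$ is a guessing model for sets of size $\omega_1$ if it is an $\omega_1$-guessing model for every $z\in M$ with $|z|=\omega_1$. The principle $\mathsf{GMP}(\omega_1,\omega_2,H(\omega_2))$ says that the set of $\omega_1$-guessing models $M\prec H(\omega_2)$ with $|M|<\omega_2$ is stationary in $\mathscr P_{\omega_2}H(\omega_2)$. **Corollary.** Consider the statement $(\ast)$ for every regular $\theta\ge\omega_2$, the set $$\{M\prec H(\theta) : |M|<\omega_2\text{ and } M\text{ is a guessing model for sets of size }\omega_1\}$$ is stationary in $\mathscr P_{\omega_2}H(\theta)$. If $\mathsf{SP}(\omega_1,\omega_2,H(\omega_2))$ holds, then $(\ast)$ holds,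 and $\mathsf{GMP}(\omega_1,\omega_2,H(\omega_2))$ holds. Moreover, $(\ast)$ and $\mathsf{GMP}(\omega_1,\omega_2,H(\omega_2))$ are equivalent. -/

import Mathlib

universe u

namespace SmallGuessing

open Cardinal

/-! Sets are elements of Mathlib's `ZFSet`; `ZFSet.card x` is the cardinality of the set `x`. -/

lemma exists_rank_eq_of_isTransitive {t : ZFSet.{u}} (ht : t.IsTransitive) {o : Ordinal.{u}}
    (ho : o < t.rank) : ∃ y ∈ t, y.rank = o := by
  have key : ∀ y : ZFSet.{u}, y ∈ t → o ≤ y.rank → ∃ y' ∈ t, y'.rank = o := by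
    intro y
    induction y using ZFSet.inductionOn with
    | _ y ih =>
      intro hy hle
      rcases hle.eq_or_lt with h | h
      · exact ⟨y, hy, h.symm⟩
      · obtain ⟨w, hw, hle'⟩ := ZFSet.lt_rank_iff.1 h
        exact ih w hw (ht.mem_trans hw hy) hle'
  obtain ⟨y, hy, hle⟩ := ZFSet.lt_rank_iff.1 ho
  exact key y hy hle

lemma rank_lt_ord_of_isTransitive {t : ZFSet.{u}} (ht : t.IsTransitive) {θ : Cardinal.{u}}
    (h : t.card < θ) : t.rank < θ.ord := by
  rw [Cardinal.lt_ord]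
  refine lt_of_le_of_lt ?_ h
  choose f hf hr using fun o : Set.Iio t.rank => exists_rank_eq_of_isTransitive ht o.2
  have hinj : Function.Injective (fun o : Set.Iio t.rank => (⟨f o, hf o⟩ : t)) := by
    intro a b hab
    have h1 : f a = f b := congrArg Subtype.val hab
    exact Subtype.ext (by rw [← hr a, ← hr b, h1])
  have h2 := Cardinal.mk_le_of_injective hinj
  rw [ZFSet.cardinalMk_coe_sort, Cardinal.mk_Iio_ordinal] at h2
  exact Cardinal.lift_le.1 h2

/-- `H(θ)`: the set of all `x` whose transitive closure has cardinality less than `θ`,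
i.e. which are contained in a transitive set of cardinality less than `θ`. The restriction to the
level `V_θ` of the cumulative hierarchy only serves to get a set; see `mem_H`. -/
noncomputable def H (θ : Cardinal.{u}) : ZFSet.{u} :=
  (ZFSet.vonNeumann θ.ord).sep fun x => ∃ t : ZFSet.{u}, t.IsTransitive ∧ x ⊆ t ∧ t.card < θ

theorem mem_H {θ : Cardinal.{u}} {x : ZFSet.{u}} :
    x ∈ H θ ↔ ∃ t : ZFSet.{u}, t.IsTransitive ∧ x ⊆ t ∧ t.card < θ := by
  refine ⟨fun h => (ZFSet.mem_sep.1 h).2, fun h => ZFSet.mem_sep.2 ⟨?_, h⟩⟩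
  obtain ⟨t, ht, hxt, hc⟩ := h
  rw [ZFSet.mem_vonNeumann]
  exact (ZFSet.rank_mono hxt).trans_lt (rank_lt_ord_of_isTransitive ht hc)

/-- `𝒫_κ X`: the subsets of `X` of cardinality less than `κ`. -/
def Pk (κ : Cardinal.{u}) (X : ZFSet.{u}) : Set ZFSet.{u} :=
  {x | x ⊆ X ∧ x.card < κ}

/-- `C` is closed and cofinal in `𝒫_κ X`. -/
structure IsClub (κ : Cardinal.{u}) (X : ZFSet.{u}) (C : Set ZFSet.{u}) : Prop where
  subset : C ⊆ Pk κ X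
  closed : ∀ D : ZFSet.{u}, D.Nonempty → (∀ x ∈ D, x ∈ C) → D.card < κ →
    (∀ x ∈ D, ∀ y ∈ D, x ⊆ y ∨ y ⊆ x) → ZFSet.sUnion D ∈ C
  cofinal : ∀ x ∈ Pk κ X, ∃ y ∈ C, x ⊆ y

/-- `S` is a stationary subset of `𝒫_κ X`. -/
def IsStationary (κ : Cardinal.{u}) (X : ZFSet.{u}) (S : Set ZFSet.{u}) : Prop :=
  S ⊆ Pk κ X ∧ ∀ C : Set ZFSet.{u}, IsClub κ X C → (S ∩ C).Nonempty

/-- `⟨d x | x ∈ 𝒫_κ X⟩` is a `(κ, X)`-list (values of `d` outside `𝒫_κ X` are irrelevant). -/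
def IsList (κ : Cardinal.{u}) (X : ZFSet.{u}) (d : ZFSet.{u} → ZFSet.{u}) : Prop :=
  ∀ x ∈ Pk κ X, d x ⊆ x

/-- The list `d` is `μ`-slender: for all sufficiently large cardinals `θ` there is a club of
`M ∈ 𝒫_κ H(θ)` such that `d_{M ∩ X} ∩ y ∈ M` for all `y ∈ M ∩ 𝒫_μ X`. -/
def IsSlender (μ κ : Cardinal.{u}) (X : ZFSet.{u}) (d : ZFSet.{u} → ZFSet.{u}) : Prop :=
  ∃ θ₀ : Cardinal.{u}, ∀ θ : Cardinal.{u}, θ₀ ≤ θ →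
    ∃ C : Set ZFSet.{u}, IsClub κ (H θ) C ∧
      ∀ M ∈ C, ∀ y ∈ M, y ∈ Pk μ X → d (M ∩ X) ∩ y ∈ M

/-- `b ⊆ X` is a cofinal branch of the list `d`. -/
def IsCofinalBranch (κ : Cardinal.{u}) (X : ZFSet.{u}) (d : ZFSet.{u} → ZFSet.{u})
    (b : ZFSet.{u}) : Prop :=
  b ⊆ X ∧ ∀ x ∈ Pk κ X, ∃ z ∈ Pk κ X, x ⊆ z ∧ b ∩ x = d z ∩ x

/-- The slender tree property `SP(μ, κ, X)`. -/
def SP (μ κ : Cardinal.{u}) (X : ZFSet.{u}) : Prop :=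
  ∀ d : ZFSet.{u} → ZFSet.{u}, IsList κ X d → IsSlender μ κ X d →
    ∃ b : ZFSet.{u}, IsCofinalBranch κ X d b

/-- The relation symbols of the language of set theory: one binary symbol. -/
inductive SetRel : ℕ → Type
  | mem : SetRel 2

/-- The first-order language `{∈}` of set theory. -/
def setLang : FirstOrder.Language where
  Functions := fun _ => Empty
  Relations := SetRel

/-- Every set `X` is regarded as the structure `(X, ∈)`. -/
instance setStructure (X : ZFSet.{u}) : setLang.Structure X where
  funMap := fun f _ => f.elim
  RelMap := fun r => match r with
    | SetRel.mem => fun v => (v 0 : ZFSet.{u}) ∈ (v 1 : ZFSet.{u})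

/-- `(M, ∈) ≺ (X, ∈)`: the inclusion map is defined and is an elementary embedding. -/
def IsElementarySub (M X : ZFSet.{u}) : Prop :=
  ∃ j : setLang.ElementaryEmbedding M X, ∀ a : M, (j a : ZFSet.{u}) = a

/-- `d ⊆ x` is `(μ, M)`-approximated. -/
def IsApproximated (μ : Cardinal.{u}) (M x d : ZFSet.{u}) : Prop :=
  ∀ z ∈ M, z ∈ Pk μ x → ∃ e ∈ M, d ∩ z = e ∩ z

/-- `d` is `M`-guessed. -/
def IsGuessed (M d : ZFSet.{u}) : Prop :=
  ∃ e ∈ M, d ∩ M = e ∩ M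

/-- `M ≺ H(θ)` is a `μ`-guessing model for the set `x ∈ M`. -/
def IsGuessingModelFor (μ θ : Cardinal.{u}) (M x : ZFSet.{u}) : Prop :=
  IsElementarySub M (H θ) ∧ x ∈ M ∧
    ∀ d : ZFSet.{u}, d ⊆ x → IsApproximated μ M x d → IsGuessed M d

/-- `M ≺ H(θ)` is a `μ`-guessing model. -/
def IsGuessingModel (μ θ : Cardinal.{u}) (M : ZFSet.{u}) : Prop :=
  IsElementarySub M (H θ) ∧ ∀ x ∈ M, IsGuessingModelFor μ θ M x

/-- `M ≺ H(θ)` is a guessing model (i.e. an `ω₁`-guessing model) for sets of size `ω₁`. -/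
def IsGuessingModelForSizeOmegaOne (θ : Cardinal.{u}) (M : ZFSet.{u}) : Prop :=
  IsElementarySub M (H θ) ∧ ∀ z ∈ M, z.card = ℵ_ 1 → IsGuessingModelFor (ℵ_ 1) θ M z

/-- The guessing model property `GMP(μ, κ, θ)`. -/
def GMP (μ κ θ : Cardinal.{u}) : Prop :=
  IsStationary κ (H θ) {M | M ∈ Pk κ (H θ) ∧ IsGuessingModel μ θ M}

/-- For every regular `θ ≥ ω₂`, the models `M ≺ H(θ)` with `|M| < ω₂` that are guessing for sets
of size `ω₁` form a stationary subset of `𝒫_{ω₂} H(θ)`. -/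
def StationarilyManySmallGuessingModels : Prop :=
  ∀ θ : Cardinal.{u}, θ.IsRegular → ℵ_ 2 ≤ θ →
    IsStationary (ℵ_ 2) (H θ)
      {M | M ∈ Pk (ℵ_ 2) (H θ) ∧ IsGuessingModelForSizeOmegaOne θ M}

end SmallGuessing

/-!
Let `κ = ν⁺`, and let `Λ` be the ordinal `ν`. Every set of size at most `ν` is enumerated by `Λ`,
so a model `M ⊇ Λ` which is closed under coding along these enumerations guesses for all of its
elements of size at most `ν` as soon as it guesses for the single set `Λ`. Since all subsets of `Λ`
lie in `H(κ)`, this depends on `M ∩ H(κ)` only, and in `H(κ)` every set has size at most `ν`. So it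
remains to compare the clubs of `𝒫_κ H(θ)` with those of `𝒫_κ H(κ)`. Clubs project along
`M ↦ M ∩ H(κ)` by Menas' theorem: a club contains all sets that are closed under a suitable
function defined on finite sets.

If almost no `M ∈ 𝒫_κ H(κ)` guesses for `Λ`, choose `D_M ⊆ Λ` outside of `M` whose small pieces are
in `M` for almost all `M`. The list of the sets `D_M ∩ M` is slender. For a cofinal branch `b`,
some `z` with `Λ ⊆ z` and `b ∩ Λ ∈ z` satisfies `b ∩ Λ = D_z`, which contradicts `D_z ∉ z`.
-/

namespace SmallGuessing

open Cardinal Filter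

universe v

section Pk

variable {κ : Cardinal.{u}} {X x y : ZFSet.{u}} {ι : Type v}

lemma card_iUnion_lt (hκ : κ.IsRegular) [Small.{u} ι] {A : ι → ZFSet.{u}}
    (hι : lift.{u} #ι < lift.{v} κ) (hA : ∀ i, (A i).card < κ) : (ZFSet.iUnion A).card < κ := by
  let e := equivShrink.{u} ι
  have hlt : #(Shrink.{u} ι) < κ := by rwa [← lift_lt.{u, v}, lift_mk_shrink']
  have hreindex : ZFSet.iUnion A = ZFSet.iUnion (A ∘ e.symm) := by
    ext w
    simp only [ZFSet.mem_iUnion, Function.comp_apply, e.exists_congr_left]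
  have hle := ZFSet.lift_card_iUnion_le_sum_card (f := A ∘ e.symm)
  rw [lift_id, ← hreindex] at hle
  exact hle.trans_lt (sum_lt_of_isRegular hκ hlt fun i => hA _)

lemma inter_mem_Pk (hx : x.card < κ) : x ∩ X ∈ Pk κ X :=
  ⟨fun _ ha => (ZFSet.mem_inter.1 ha).2,
    (ZFSet.card_mono fun _ ha => (ZFSet.mem_inter.1 ha).1).trans_lt hx⟩

lemma iUnion_mem_Pk (hκ : κ.IsRegular) [Small.{u} ι] {A : ι → ZFSet.{u}}
    (hι : lift.{u} #ι < lift.{v} κ) (hA : ∀ i, A i ∈ Pk κ X) : ZFSet.iUnion A ∈ Pk κ X := by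
  refine ⟨fun a ha => ?_, card_iUnion_lt hκ hι fun i => (hA i).2⟩
  obtain ⟨i, hi⟩ := ZFSet.mem_iUnion.1 ha
  exact (hA i).1 hi

lemma sUnion_mem_Pk (hκ : κ.IsRegular) {D : ZFSet.{u}} (hD : D.card < κ)
    (h : ∀ x ∈ D, x ∈ Pk κ X) : ZFSet.sUnion D ∈ Pk κ X := by
  have hindex : ZFSet.sUnion D = ZFSet.iUnion fun x : D => x.1 := by
    ext w
    simp [ZFSet.mem_iUnion]
  rw [hindex]
  refine iUnion_mem_Pk hκ ?_ fun x => h x.1 x.2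
  simpa [ZFSet.cardinalMk_coe_sort] using hD

lemma union_mem_Pk (hκ : ℵ₀ ≤ κ) (hx : x ∈ Pk κ X) (hy : y ∈ Pk κ X) : x ∪ y ∈ Pk κ X := by
  refine ⟨fun a ha => ?_, ZFSet.card_union_le.trans_lt (add_lt_of_lt hκ hx.2 hy.2)⟩
  exact (ZFSet.mem_union.1 ha).elim (fun h => hx.1 h) fun h => hy.1 h

lemma range_mem_Pk (hκ : ℵ₀ < κ) [Countable ι] {f : ι → ZFSet.{u}} (hf : ∀ i, f i ∈ X) :
    ZFSet.range f ∈ Pk κ X := by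
  refine ⟨fun a ha => ?_, ?_⟩
  · obtain ⟨i, rfl⟩ := ZFSet.mem_range.1 ha
    exact hf i
  · have hcard : lift.{v} (ZFSet.range f).card ≤ ℵ₀ :=
      ZFSet.lift_card_range_le.trans (lift_le_aleph0.2 mk_le_aleph0)
    exact (lift_le_aleph0.1 hcard).trans_lt hκ

lemma singleton_mem_Pk (hκ : ℵ₀ < κ) {a : ZFSet.{u}} (ha : a ∈ X) : {a} ∈ Pk κ X := by
  refine ⟨fun b hb => ?_, ?_⟩
  · rwa [ZFSet.mem_singleton.1 hb]
  · rw [ZFSet.card_singleton]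
    exact one_lt_aleph0.trans hκ

end Pk

section Hull

variable {κ : Cardinal.{u}} {X x y M : ZFSet.{u}} {F : Finset ZFSet.{u} → ZFSet.{u}}

instance (x : ZFSet.{u}) : Small.{u} (Finset x) :=
  small_of_injective (β := Set x) Finset.coe_injective

/-- The union of the values of `F` at the finite subsets of `x`. It need not contain `x`, and it
need not be closed under `F`. -/
noncomputable def hull (F : Finset ZFSet.{u} → ZFSet.{u}) (x : ZFSet.{u}) : ZFSet.{u} :=
  ZFSet.iUnion fun e : Finset x => F (e.map (.subtype _))

lemma mem_hull {w : ZFSet.{u}} :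
    w ∈ hull F x ↔ ∃ e : Finset ZFSet.{u}, (e : Set ZFSet.{u}) ⊆ x ∧ w ∈ F e := by
  classical
  rw [hull, ZFSet.mem_iUnion]
  constructor
  · rintro ⟨e, he⟩
    exact ⟨_, by simp +contextual [Set.subset_def], he⟩
  · rintro ⟨e, hex, he⟩
    exact ⟨e.subtype (· ∈ x), by rwa [Finset.subtype_map_of_mem (p := (· ∈ x)) hex]⟩

lemma hull_mono (h : x ⊆ y) : hull F x ⊆ hull F y := by
  intro w hw
  obtain ⟨e, he, hw⟩ := mem_hull.1 hw
  exact mem_hull.2 ⟨e, he.trans h, hw⟩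

lemma hull_iUnion_of_directed {ι : Type v} [Small.{u} ι] [Nonempty ι] {A : ι → ZFSet.{u}}
    (hA : Directed (· ⊆ ·) A) : hull F (ZFSet.iUnion A) = ZFSet.iUnion fun i => hull F (A i) := by
  ext w
  simp only [ZFSet.mem_iUnion, mem_hull]
  constructor
  · rintro ⟨e, he, hw⟩
    obtain ⟨i, hi⟩ := Directed.exists_mem_subset_of_finset_subset_biUnion
      (f := fun i => (A i : Set ZFSet.{u})) hA (by rwa [ZFSet.coe_iUnion] at he)
    exact ⟨i, e, hi, hw⟩
  · rintro ⟨i, e, he, hw⟩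
    exact ⟨e, he.trans (ZFSet.subset_iUnion A i), hw⟩

lemma hull_eq_of_finset (hF : Monotone F) {e : Finset ZFSet.{u}} (he : (e : Set ZFSet.{u}) = x) :
    hull F x = F e := by
  ext w
  rw [mem_hull, ← he]
  exact ⟨fun ⟨t, ht, hw⟩ => hF (Finset.coe_subset.1 ht) hw, fun hw => ⟨e, subset_rfl, hw⟩⟩

lemma hull_mem_Pk (hκ : κ.IsRegular) (hκ₀ : ℵ₀ < κ) (hF : ∀ e, F e ∈ Pk κ X) (hx : x.card < κ) :
    hull F x ∈ Pk κ X := by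
  refine iUnion_mem_Pk hκ ?_ fun e => hF _
  rw [lift_id'.{u, u + 1}]
  cases finite_or_infinite x
  · exact (lt_aleph0_of_finite _).trans (aleph0_lt_lift.2 hκ₀)
  · rwa [mk_finset_of_infinite, ZFSet.cardinalMk_coe_sort, lift_lt]

/-- `M` is closed under `F`, a function which assigns to a finite set of elements of `M` a set of
elements that `M` has to contain. -/
def IsClosedUnder (F : Finset ZFSet.{u} → ZFSet.{u}) (M : ZFSet.{u}) : Prop :=
  ∀ e : Finset ZFSet.{u}, (e : Set ZFSet.{u}) ⊆ M → F e ⊆ M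

lemma IsClosedUnder.mono {G : Finset ZFSet.{u} → ZFSet.{u}} (hM : IsClosedUnder G M)
    (h : ∀ e, F e ⊆ G e) : IsClosedUnder F M :=
  fun e he _ hw => hM e he (h e hw)

lemma IsClosedUnder.hull_subset (h : IsClosedUnder F M) : hull F M ⊆ M := by
  intro w hw
  obtain ⟨e, he, hw⟩ := mem_hull.1 hw
  exact h e he hw

lemma isClosedUnder_of_hull_subset (h : hull F M ⊆ M) : IsClosedUnder F M :=
  fun e he _ hw => h (mem_hull.2 ⟨e, he, hw⟩)

lemma exists_isClosedUnder (hκ : κ.IsRegular) (hκ₀ : ℵ₀ < κ) (hF : ∀ e, F e ∈ Pk κ X)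
    (hx : x ∈ Pk κ X) : ∃ M ∈ Pk κ X, x ⊆ M ∧ IsClosedUnder F M := by
  let A : ℕ → ZFSet.{u} := fun n => (fun y => y ∪ hull F y)^[n] x
  have hsucc (n : ℕ) : A (n + 1) = A n ∪ hull F (A n) := Function.iterate_succ_apply' ..
  have hmono : Monotone A := monotone_nat_of_le_succ fun n a ha => by
    rw [hsucc]
    exact ZFSet.mem_union.2 (.inl ha)
  have hmem (n : ℕ) : A n ∈ Pk κ X := by
    induction n with
    | zero => exact hx
    | succ n ih =>
      rw [hsucc]
      exact union_mem_Pk hκ₀.le ih (hull_mem_Pk hκ hκ₀ hF ih.2)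
  refine ⟨ZFSet.iUnion A, iUnion_mem_Pk hκ (by simpa using hκ₀) hmem,
    ZFSet.subset_iUnion A 0, isClosedUnder_of_hull_subset fun w hw => ?_⟩
  rw [hull_iUnion_of_directed hmono.directed_le] at hw
  obtain ⟨n, hn⟩ := ZFSet.mem_iUnion.1 hw
  refine ZFSet.subset_iUnion A (n + 1) ?_
  rw [hsucc]
  exact ZFSet.mem_union.2 (.inr hn)

lemma isClub_isClosedUnder (hκ : κ.IsRegular) (hκ₀ : ℵ₀ < κ) (hF : ∀ e, F e ∈ Pk κ X) :
    IsClub κ X {M | M ∈ Pk κ X ∧ IsClosedUnder F M} where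
  subset _ h := h.1
  closed D hne hD hcard hchain := by
    refine ⟨sUnion_mem_Pk hκ hcard fun x hx => (hD x hx).1, fun e he => ?_⟩
    have hdir : DirectedOn (· ⊆ ·) (D : Set ZFSet.{u}) :=
      IsChain.directedOn fun x hx y hy _ => hchain x hx y hy
    obtain ⟨x, hx, hex⟩ := DirectedOn.exists_mem_subset_of_finset_subset_biUnion
      (f := fun x : ZFSet.{u} => (x : Set ZFSet.{u})) hne hdir
      (by simpa [ZFSet.coe_sUnion, Set.sUnion_eq_biUnion] using he)
    exact fun w hw => ZFSet.mem_sUnion.2 ⟨x, hx, (hD x hx).2 e hex hw⟩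
  cofinal x hx := by
    obtain ⟨M, hM, hxM, hcl⟩ := exists_isClosedUnder hκ hκ₀ hF hx
    exact ⟨M, ⟨hM, hcl⟩, hxM⟩

end Hull

section Menas

variable {κ : Cardinal.{u}} {X x : ZFSet.{u}} {C : Set ZFSet.{u}}
  {F : Finset ZFSet.{u} → ZFSet.{u}}

lemma exists_range_eq {α : Type u} (h : #α = x.card) :
    ∃ g : α → ZFSet.{u}, ZFSet.range g = x := by
  obtain ⟨e⟩ := Cardinal.eq.1 (h : #α = #(Shrink.{u} x))
  let e' := e.trans (equivShrink x).symm
  refine ⟨fun i => (e' i).1, ZFSet.ext fun a => ZFSet.mem_range.trans ⟨?_, fun ha => ?_⟩⟩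
  · rintro ⟨i, rfl⟩
    exact (e' i).2
  · exact ⟨e'.symm ⟨a, ha⟩, by simp⟩

lemma exists_monotone_iUnion_eq (hx : ℵ₀ ≤ x.card) :
    ∃ A : x.card.ord.ToType → ZFSet.{u},
      Monotone A ∧ (∀ i, (A i).card < x.card) ∧ ZFSet.iUnion A = x := by
  have := Cardinal.noMaxOrder hx
  obtain ⟨g, hg⟩ := exists_range_eq (mk_ord_toType x.card)
  refine ⟨fun i => ZFSet.range fun j : Set.Iio i => g j, fun i j hij a ha => ?_, fun i => ?_, ?_⟩
  · obtain ⟨k, rfl⟩ := ZFSet.mem_range.1 ha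
    exact ZFSet.mem_range.2 ⟨⟨k, k.2.trans_le hij⟩, rfl⟩
  · have hle := ZFSet.lift_card_range_le (f := fun j : Set.Iio i => g j)
    rw [lift_id, lift_id] at hle
    simpa using hle.trans_lt (mk_Iio_lt i (by simp))
  · ext a
    simp only [← hg, ZFSet.mem_iUnion, ZFSet.mem_range]
    constructor
    · rintro ⟨i, j, rfl⟩
      exact ⟨j, rfl⟩
    · rintro ⟨j, rfl⟩
      obtain ⟨i, hi⟩ := exists_gt j
      exact ⟨i, ⟨j, hi⟩, rfl⟩

lemma IsClub.iUnion_mem (hC : IsClub κ X C) {ι : Type u} [Nonempty ι] [LinearOrder ι]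
    {A : ι → ZFSet.{u}} (hA : Monotone A) (hι : #ι < κ) (hmem : ∀ i, A i ∈ C) :
    ZFSet.iUnion A ∈ C := by
  refine hC.closed (ZFSet.range A) ⟨A (Classical.arbitrary ι), by simp⟩ ?_ ?_ ?_
  · intro x hx
    obtain ⟨i, rfl⟩ := ZFSet.mem_range.1 hx
    exact hmem i
  · have hle := ZFSet.lift_card_range_le (f := A)
    rw [lift_id, lift_id] at hle
    exact hle.trans_lt hι
  · intro x hx y hy
    obtain ⟨i, rfl⟩ := ZFSet.mem_range.1 hx
    obtain ⟨j, rfl⟩ := ZFSet.mem_range.1 hy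
    exact (le_total i j).imp (fun h => hA h) fun h => hA h

lemma IsClub.exists_monotone (hκ : κ.IsRegular) (hκ₀ : ℵ₀ < κ) (hC : IsClub κ X C) :
    ∃ F : Finset ZFSet.{u} → ZFSet.{u},
      Monotone F ∧ (∀ e, F e ∈ C) ∧ ∀ a ∈ X, a ∈ F {a} := by
  classical
  choose g hgC hg using hC.cofinal
  let seed (e : Finset ZFSet.{u}) (f : ∀ t ⊂ e, C) : ZFSet.{u} :=
    ZFSet.range (fun a : {a : e // a.1 ∈ X} => a.1.1) ∪
      ZFSet.iUnion fun t : e.ssubsets => (f t.1 (Finset.mem_ssubsets.1 t.2)).1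
  have hseed (e) (f : ∀ t ⊂ e, C) : seed e f ∈ Pk κ X := by
    refine union_mem_Pk hκ₀.le (range_mem_Pk hκ₀ fun a => a.2)
      (iUnion_mem_Pk hκ ?_ fun t => hC.subset (Subtype.prop _))
    exact (lift_lt_aleph0.2 (lt_aleph0_of_finite _)).trans (aleph0_lt_lift.2 hκ₀)
  let next (e : Finset ZFSet.{u}) (f : ∀ t ⊂ e, C) : C := ⟨g _ (hseed e f), hgC _ _⟩
  let F : Finset ZFSet.{u} → C := Finset.strongInduction (p := fun _ => C) next
  have hF (e) : seed e (fun t _ => F t) ⊆ (F e).1 := by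
    rw [show F e = next e fun t _ => F t from Finset.strongInduction_eq next e]
    exact hg _ _
  refine ⟨fun e => F e, fun t e hte => ?_, fun e => (F e).2, fun a ha => ?_⟩
  · rcases hte.eq_or_ssubset with rfl | hss
    · exact le_rfl
    · exact fun w hw => hF e <| ZFSet.mem_union.2 <| .inr <|
        ZFSet.mem_iUnion.2 ⟨⟨t, Finset.mem_ssubsets.2 hss⟩, hw⟩
  · exact hF {a} <| ZFSet.mem_union.2 <| .inl <|
      ZFSet.mem_range.2 ⟨⟨⟨a, Finset.mem_singleton_self a⟩, ha⟩, rfl⟩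

lemma IsClub.hull_mem (hC : IsClub κ X C) (hF : Monotone F) (hFC : ∀ e, F e ∈ C)
    (hx : x.card < κ) : hull F x ∈ C := by
  induction hc : x.card using WellFoundedLT.induction generalizing x with
  | ind c ih =>
  subst hc
  rcases lt_or_ge x.card ℵ₀ with hfin | hinf
  · have hfinite : (x : Set ZFSet.{u}).Finite := by
      rw [← lt_aleph0_iff_set_finite]
      exact ZFSet.cardinalMk_coe_sort.trans_lt (lift_lt_aleph0.2 hfin)
    rw [hull_eq_of_finset hF hfinite.coe_toFinset]
    exact hFC _
  · obtain ⟨A, hA, hcard, hAx⟩ := exists_monotone_iUnion_eq hinf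
    have : Nonempty x.card.ord.ToType := by
      rw [← mk_ne_zero_iff, mk_ord_toType]
      exact (aleph0_pos.trans_le hinf).ne'
    rw [← congrArg (hull F) hAx, hull_iUnion_of_directed hA.directed_le]
    exact hC.iUnion_mem (fun i j hij => hull_mono (hA hij)) (by rwa [mk_ord_toType])
      fun i => ih _ (hcard i) ((hcard i).trans hx) rfl

end Menas

section ClubFilter

variable {κ : Cardinal.{u}} {X Y : ZFSet.{u}}

/-- The club filter on `𝒫_κ X`, as a filter on `ZFSet`: it is generated by the clubs. -/
def clubFilter (κ : Cardinal.{u}) (X : ZFSet.{u}) : Filter ZFSet.{u} :=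
  ⨅ (C : Set ZFSet.{u}) (_ : IsClub κ X C), 𝓟 C

lemma IsClub.exists_isClosedUnder_subset (hκ : κ.IsRegular) (hκ₀ : ℵ₀ < κ) {C : Set ZFSet.{u}}
    (hC : IsClub κ X C) :
    ∃ F : Finset ZFSet.{u} → ZFSet.{u}, (∀ e, F e ∈ Pk κ X) ∧
      {M | M ∈ Pk κ X ∧ IsClosedUnder F M} ⊆ C := by
  obtain ⟨F, hF, hFC, hself⟩ := hC.exists_monotone hκ hκ₀
  refine ⟨F, fun e => hC.subset (hFC e), fun M ⟨hM, hcl⟩ => ?_⟩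
  have hle : M ⊆ hull F M := fun a ha => mem_hull.2 ⟨{a}, by simpa using ha, hself a (hM.1 ha)⟩
  rw [subset_antisymm hle hcl.hull_subset]
  exact hC.hull_mem hF hFC hM.2

lemma hasBasis_clubFilter_isClub (hκ : κ.IsRegular) (hκ₀ : ℵ₀ < κ) :
    (clubFilter κ X).HasBasis (IsClub κ X) id := by
  refine hasBasis_biInf_principal' (fun C hC D hD => ?_) ?_
  · obtain ⟨F, hF, hFC⟩ := hC.exists_isClosedUnder_subset hκ hκ₀
    obtain ⟨G, hG, hGD⟩ := hD.exists_isClosedUnder_subset hκ hκ₀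
    refine ⟨_, isClub_isClosedUnder hκ hκ₀ fun e => union_mem_Pk hκ₀.le (hF e) (hG e),
      fun M hM => hFC ⟨hM.1, hM.2.mono fun e w hw => ?_⟩,
      fun M hM => hGD ⟨hM.1, hM.2.mono fun e w hw => ?_⟩⟩
    · exact ZFSet.mem_union.2 (.inl hw)
    · exact ZFSet.mem_union.2 (.inr hw)
  · exact ⟨_, isClub_isClosedUnder hκ hκ₀ fun _ => ⟨ZFSet.empty_subset X, by simp [hκ.pos]⟩⟩

lemma hasBasis_clubFilter (hκ : κ.IsRegular) (hκ₀ : ℵ₀ < κ) :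
    (clubFilter κ X).HasBasis (fun F : Finset ZFSet.{u} → ZFSet.{u} => ∀ e, F e ∈ Pk κ X)
      fun F => {M | M ∈ Pk κ X ∧ IsClosedUnder F M} :=
  (hasBasis_clubFilter_isClub hκ hκ₀).to_hasBasis
    (fun _ hC => hC.exists_isClosedUnder_subset hκ hκ₀)
    fun _ hF => ⟨_, isClub_isClosedUnder hκ hκ₀ hF, subset_rfl⟩

lemma isStationary_iff_frequently (hκ : κ.IsRegular) (hκ₀ : ℵ₀ < κ) {S : Set ZFSet.{u}}
    (hS : S ⊆ Pk κ X) : IsStationary κ X S ↔ ∃ᶠ M in clubFilter κ X, M ∈ S := by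
  simp only [IsStationary, (hasBasis_clubFilter_isClub hκ hκ₀).frequently_iff, Set.inter_comm S,
    Set.Nonempty, Set.mem_inter_iff, id, hS, true_and]

lemma map_inter_clubFilter (hκ : κ.IsRegular) (hκ₀ : ℵ₀ < κ) (hXY : X ⊆ Y) :
    (clubFilter κ Y).map (· ∩ X) = clubFilter κ X := by
  refine le_antisymm ((hasBasis_clubFilter hκ hκ₀).ge_iff.2 fun F hF => ?_) fun S hS => ?_
  · rw [mem_map]
    filter_upwards [(hasBasis_clubFilter hκ hκ₀).mem_of_mem (i := F)
      fun e => ⟨(hF e).1.trans hXY, (hF e).2⟩] with N ⟨hN, hcl⟩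
    refine ⟨inter_mem_Pk hN.2, fun e he a ha => ?_⟩
    exact ZFSet.mem_inter.2 ⟨hcl e (fun b hb => (ZFSet.mem_inter.1 (he hb)).1) ha, (hF e).1 ha⟩
  · obtain ⟨C, hC, hCS⟩ := (hasBasis_clubFilter_isClub hκ hκ₀).mem_iff.1 hS
    obtain ⟨F, hF, hFC, hself⟩ := hC.exists_monotone hκ hκ₀
    refine (hasBasis_clubFilter hκ hκ₀).mem_iff.2 ⟨fun e => F e ∩ X,
      fun e => inter_mem_Pk (hC.subset (hFC e)).2, fun M ⟨hM, hcl⟩ => ?_⟩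
    have htrace : hull F M ∩ X = M := by
      ext a
      rw [ZFSet.mem_inter]
      constructor
      · rintro ⟨ha, haX⟩
        obtain ⟨e, he, hae⟩ := mem_hull.1 ha
        exact hcl e he (ZFSet.mem_inter.2 ⟨hae, haX⟩)
      · exact fun ha => ⟨mem_hull.2 ⟨{a}, by simpa using ha, hself a (hXY (hM.1 ha))⟩, hM.1 ha⟩
    exact htrace ▸ hCS (hC.hull_mem hF hFC hM.2)

lemma eventually_mem_Pk (hκ : κ.IsRegular) (hκ₀ : ℵ₀ < κ) :
    ∀ᶠ M in clubFilter κ X, M ∈ Pk κ X := by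
  obtain ⟨C, hC⟩ := (hasBasis_clubFilter_isClub (X := X) hκ hκ₀).ex_mem
  exact mem_of_superset ((hasBasis_clubFilter_isClub hκ hκ₀).mem_of_mem hC) hC.subset

lemma eventually_superset (hκ : κ.IsRegular) (hκ₀ : ℵ₀ < κ) {x : ZFSet.{u}} (hx : x ∈ Pk κ X) :
    ∀ᶠ M in clubFilter κ X, x ⊆ M :=
  mem_of_superset ((hasBasis_clubFilter hκ hκ₀).mem_of_mem (i := fun _ => x) fun _ => hx)
    fun _ h => h.2 ∅ (by simp)

lemma eventually_mem (hκ : κ.IsRegular) (hκ₀ : ℵ₀ < κ) {a : ZFSet.{u}} (ha : a ∈ X) :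
    ∀ᶠ M in clubFilter κ X, a ∈ M := by
  filter_upwards [eventually_superset hκ hκ₀ (singleton_mem_Pk hκ₀ ha)] with M hM
  exact hM (ZFSet.mem_singleton.2 rfl)

lemma eventually_forall_finitary_mem (hκ : κ.IsRegular) (hκ₀ : ℵ₀ < κ) {ι : Type v} [Countable ι]
    {n : ι → ℕ} (f : ∀ i, (Fin (n i) → X) → X) :
    ∀ᶠ M in clubFilter κ X,
      ∀ i (v : Fin (n i) → X), (∀ j, (v j : ZFSet.{u}) ∈ M) → (f i v : ZFSet.{u}) ∈ M := by
  classical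
  let F (e : Finset ZFSet.{u}) : ZFSet.{u} :=
    ZFSet.range fun p : Σ i, Fin (n i) → e.subtype (· ∈ X) => (f p.1 fun j => p.2 j : ZFSet.{u})
  refine mem_of_superset ((hasBasis_clubFilter hκ hκ₀).mem_of_mem (i := F)
    fun e => range_mem_Pk hκ₀ fun p => (f _ _).2) fun M ⟨_, hcl⟩ i v hv => ?_
  refine hcl (Finset.univ.image fun j => (v j : ZFSet.{u})) (by simpa [Set.range_subset_iff]) ?_
  exact ZFSet.mem_range.2 ⟨⟨i, fun j => ⟨v j, by simp⟩⟩, rfl⟩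

lemma eventually_forall_binary_mem (hκ : κ.IsRegular) (hκ₀ : ℵ₀ < κ)
    {f : ZFSet.{u} → ZFSet.{u} → ZFSet.{u}} (hf : ∀ a ∈ X, ∀ b ∈ X, f a b ∈ X) :
    ∀ᶠ M in clubFilter κ X, ∀ a ∈ M, ∀ b ∈ M, f a b ∈ M := by
  filter_upwards [eventually_mem_Pk hκ hκ₀, eventually_forall_finitary_mem hκ hκ₀ (ι := Unit)
    (n := fun _ => 2) fun _ v => ⟨f (v 0) (v 1), hf _ (v 0).2 _ (v 1).2⟩] with M hM h a ha b hb
  exact h () ![⟨a, hM.1 ha⟩, ⟨b, hM.1 hb⟩] (by simp [Fin.forall_fin_two, ha, hb])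

end ClubFilter

section Elementary

variable {κ : Cardinal.{u}} {M X : ZFSet.{u}}

instance : IsEmpty (Σ n, setLang.Functions n) := ⟨fun f => f.2.elim⟩

instance : Countable setLang.Symbols := by
  have hinj : Function.Injective (Sigma.fst : (Σ n, setLang.Relations n) → ℕ) := by
    rintro ⟨_, ⟨⟩⟩ ⟨_, ⟨⟩⟩ _
    rfl
  have := hinj.countable
  exact inferInstanceAs (Countable ((Σ n, setLang.Functions n) ⊕ (Σ n, setLang.Relations n)))

instance (n : ℕ) : Countable (setLang.BoundedFormula Empty n) :=
  (sigma_mk_injective (i := n) :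
    Function.Injective (Sigma.mk n : setLang.BoundedFormula Empty n → _)).countable

/-- The inclusion of a subset, as an embedding of `{∈}`-structures. -/
def inclusion (h : M ⊆ X) : setLang.Embedding M X where
  toFun a := ⟨a, h a.2⟩
  inj' _ _ hab := Subtype.ext (Subtype.mk.inj hab)
  map_fun' f := f.elim
  map_rel' r := by
    cases r
    exact fun _ => Iff.rfl

lemma eventually_isElementarySub (hκ : κ.IsRegular) (hκ₀ : ℵ₀ < κ) (hX : X.Nonempty) :
    ∀ᶠ M in clubFilter κ X, IsElementarySub M X := by
  obtain ⟨x₀, hx₀⟩ := hX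
  have : Nonempty X := ⟨⟨x₀, hx₀⟩⟩
  let skolem (φ : Σ n, setLang.BoundedFormula Empty (n + 1)) (v : Fin φ.1 → X) : X :=
    Classical.epsilon fun a => φ.2.Realize default (Fin.snoc v a : _ → X)
  filter_upwards [eventually_mem_Pk hκ hκ₀, eventually_forall_finitary_mem hκ hκ₀ skolem]
    with M hM hskolem
  refine ⟨(inclusion hM.1).toElementaryEmbedding fun n φ v a ha => ?_, fun _ => rfl⟩
  exact ⟨⟨_, hskolem ⟨n, φ⟩ (inclusion hM.1 ∘ v) fun j => (v j).2⟩,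
    Classical.epsilon_spec (p := fun a => φ.Realize default (Fin.snoc _ a : _ → X)) ⟨a, ha⟩⟩

end Elementary

section HereditarySize

variable {θ θ' : Cardinal.{u}} {x y : ZFSet.{u}}

lemma mem_H_of_subset (hx : x ∈ H θ) (h : y ⊆ x) : y ∈ H θ := by
  obtain ⟨t, ht, hxt, hc⟩ := mem_H.1 hx
  exact mem_H.2 ⟨t, ht, h.trans hxt, hc⟩

lemma mem_H_of_isTransitive (hx : x.IsTransitive) (hc : x.card < θ) : x ∈ H θ :=
  mem_H.2 ⟨x, hx, subset_rfl, hc⟩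

lemma H_mono (h : θ ≤ θ') : H θ ⊆ H θ' := by
  intro x hx
  obtain ⟨t, ht, hxt, hc⟩ := mem_H.1 hx
  exact mem_H.2 ⟨t, ht, hxt, hc.trans_le h⟩

lemma isTransitive_H (θ : Cardinal.{u}) : (H θ).IsTransitive := by
  intro x hx a ha
  obtain ⟨t, ht, hxt, hc⟩ := mem_H.1 hx
  exact mem_H.2 ⟨t, ht, ht.subset_of_mem (hxt ha), hc⟩

lemma card_lt_of_mem_H (hx : x ∈ H θ) : x.card < θ := by
  obtain ⟨t, -, hxt, hc⟩ := mem_H.1 hx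
  exact (ZFSet.card_mono hxt).trans_lt hc

lemma mem_Pk_H_of_mem_H (hx : x ∈ H θ) : x ∈ Pk θ (H θ) :=
  ⟨(isTransitive_H θ).subset_of_mem hx, card_lt_of_mem_H hx⟩

end HereditarySize

section Enumeration

variable {κ θ : Cardinal.{u}} {Λ M z d y : ZFSet.{u}}

/-- A chosen enumeration of `z` by the elements of `Λ`, possibly with repetitions. Its values
outside `z` are arbitrary, and so is the whole function if `z` has more elements than `Λ`. -/
noncomputable def enum (Λ z : ZFSet.{u}) : ZFSet.{u} → ZFSet.{u} :=
  Classical.epsilon fun g => Set.SurjOn g Λ z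

lemma surjOn_enum (hz : z.card ≤ Λ.card) : Set.SurjOn (enum Λ z) Λ z := by
  refine Classical.epsilon_spec (p := fun g : ZFSet.{u} → ZFSet.{u} => Set.SurjOn g Λ z) ?_
  have hle : #z ≤ #Λ := by simpa only [ZFSet.cardinalMk_coe_sort, Cardinal.lift_le] using hz
  obtain ⟨f⟩ := hle
  have hinj : Function.Injective fun a : z => (f a : ZFSet.{u}) :=
    Subtype.val_injective.comp f.injective
  exact ⟨Function.extend (fun a : z => (f a : ZFSet.{u})) Subtype.val id,
    fun a ha => ⟨f ⟨a, ha⟩, (f ⟨a, ha⟩).2, hinj.extend_apply _ _ ⟨a, ha⟩⟩⟩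

/-- The part in `z` of the image of `y` under the enumeration of `z` by `Λ`. -/
noncomputable def enumImage (Λ z y : ZFSet.{u}) : ZFSet.{u} :=
  z.sep fun a => ∃ i ∈ y, enum Λ z i = a

/-- The subset of `Λ` that codes `e` via the enumeration of `z` by `Λ`. -/
noncomputable def enumPreimage (Λ z e : ZFSet.{u}) : ZFSet.{u} :=
  Λ.sep fun i => enum Λ z i ∈ e

lemma card_enumImage_le : (enumImage Λ z y).card ≤ y.card := by
  have hsub : enumImage Λ z y ⊆ ZFSet.range fun i : y => enum Λ z i := by
    intro a ha
    obtain ⟨-, i, hi, rfl⟩ := ZFSet.mem_sep.1 ha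
    exact ZFSet.mem_range.2 ⟨⟨i, hi⟩, rfl⟩
  have hle := ZFSet.lift_card_range_le (f := fun i : y => enum Λ z i)
  rw [ZFSet.cardinalMk_coe_sort, lift_lift, Cardinal.lift_le] at hle
  exact (ZFSet.card_mono hsub).trans hle

lemma enumImage_enumPreimage (hz : z.card ≤ Λ.card) (hd : d ⊆ z) :
    enumImage Λ z (enumPreimage Λ z d) = d := by
  ext a
  simp only [enumImage, enumPreimage, ZFSet.mem_sep]
  constructor
  · rintro ⟨-, i, ⟨-, hi⟩, rfl⟩
    exact hi
  · intro ha
    obtain ⟨i, hi, rfl⟩ := surjOn_enum hz (hd ha)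
    exact ⟨hd ha, i, ⟨hi, ha⟩, rfl⟩

lemma enumPreimage_inter_eq {e : ZFSet.{u}} (hd : d ⊆ z)
    (hde : d ∩ enumImage Λ z y = e ∩ enumImage Λ z y) :
    enumPreimage Λ z d ∩ y = enumPreimage Λ z (e ∩ z) ∩ y := by
  ext i
  simp only [ZFSet.mem_inter, enumPreimage, ZFSet.mem_sep]
  refine and_congr_left fun hiy => and_congr_right fun _ => ?_
  by_cases hiz : enum Λ z i ∈ z
  · have himage : enum Λ z i ∈ enumImage Λ z y := ZFSet.mem_sep.2 ⟨hiz, i, hiy, rfl⟩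
    have hiff := ZFSet.ext_iff.1 hde (enum Λ z i)
    simpa only [ZFSet.mem_inter, himage, hiz, and_true] using hiff
  · exact iff_of_false (fun h => hiz (hd h)) fun h => hiz h.2

/-- `M` contains `Λ` as an element and as a subset, and is closed under intersections and under
coding and decoding along the enumerations of its elements by `Λ`. -/
structure IsEnumClosed (Λ M : ZFSet.{u}) : Prop where
  mem : Λ ∈ M
  subset : Λ ⊆ M
  inter : ∀ a ∈ M, ∀ b ∈ M, a ∩ b ∈ M
  image : ∀ z ∈ M, ∀ y ∈ M, enumImage Λ z y ∈ M
  preimage : ∀ z ∈ M, ∀ e ∈ M, enumPreimage Λ z e ∈ M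

lemma eventually_isEnumClosed (hκ : κ.IsRegular) (hκ₀ : ℵ₀ < κ) (hκθ : κ ≤ θ) (hΛ : Λ ∈ H κ) :
    ∀ᶠ M in clubFilter κ (H θ), IsEnumClosed Λ M := by
  have hΛθ : Λ ∈ H θ := H_mono hκθ hΛ
  filter_upwards [eventually_mem hκ hκ₀ hΛθ,
    eventually_superset hκ hκ₀ ⟨(isTransitive_H θ).subset_of_mem hΛθ, card_lt_of_mem_H hΛ⟩,
    eventually_forall_binary_mem hκ hκ₀ fun a ha b _ =>
      mem_H_of_subset ha fun _ h => (ZFSet.mem_inter.1 h).1,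
    eventually_forall_binary_mem hκ hκ₀ (f := enumImage Λ) fun z hz y _ =>
      mem_H_of_subset hz ZFSet.sep_subset,
    eventually_forall_binary_mem hκ hκ₀ (f := enumPreimage Λ) fun z _ e _ =>
      mem_H_of_subset hΛθ ZFSet.sep_subset]
    with M hmem hsubset hinter himage hpreimage
  exact ⟨hmem, hsubset, hinter, himage, hpreimage⟩

end Enumeration

section GuessesSubsets

variable {μ κ θ : Cardinal.{u}} {Λ M z d : ZFSet.{u}}

/-- Every subset of `Λ` whose intersections with the elements of `M ∩ 𝒫_μ Λ` are elements of `M` is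
an element of `M`. For `Λ ⊆ M`, this is the guessing property of `M` for the single set `Λ`. -/
def GuessesSubsets (μ : Cardinal.{u}) (M Λ : ZFSet.{u}) : Prop :=
  ∀ D ⊆ Λ, (∀ y ∈ M, y ∈ Pk μ Λ → D ∩ y ∈ M) → D ∈ M

lemma IsGuessingModelFor.guessesSubsets (h : IsGuessingModelFor μ θ M Λ) (hM : IsEnumClosed Λ M) :
    GuessesSubsets μ M Λ := by
  intro D hD htraces
  obtain ⟨e, he, hDe⟩ := h.2.2 D hD fun y hy hyμ => ⟨D ∩ y, htraces y hy hyμ, by ext; simp⟩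
  have hDeq : D = e ∩ Λ := by
    ext i
    have hi := ZFSet.ext_iff.1 hDe i
    simp only [ZFSet.mem_inter] at hi ⊢
    exact ⟨fun h => ⟨(hi.1 ⟨h, hM.subset (hD h)⟩).1, hD h⟩,
      fun h => (hi.2 ⟨h.1, hM.subset h.2⟩).1⟩
  exact hDeq ▸ hM.inter e he Λ hM.mem

lemma GuessesSubsets.mem_of_isApproximated (h : GuessesSubsets μ M Λ) (hM : IsEnumClosed Λ M)
    (hz : z ∈ M) (hzΛ : z.card ≤ Λ.card) (hdz : d ⊆ z) (hd : IsApproximated μ M z d) : d ∈ M := by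
  have hcode : enumPreimage Λ z d ∈ M := by
    refine h _ ZFSet.sep_subset fun y hy hyμ => ?_
    obtain ⟨e, he, hde⟩ := hd _ (hM.image z hz y hy)
      ⟨ZFSet.sep_subset, card_enumImage_le.trans_lt hyμ.2⟩
    rw [enumPreimage_inter_eq hdz hde]
    exact hM.inter _ (hM.preimage z hz _ (hM.inter e he z hz)) y hy
  exact enumImage_enumPreimage hzΛ hdz ▸ hM.image z hz _ hcode

lemma GuessesSubsets.isGuessingModelFor (h : GuessesSubsets μ M Λ) (hM : IsEnumClosed Λ M)
    (hel : IsElementarySub M (H θ)) (hz : z ∈ M) (hzΛ : z.card ≤ Λ.card) :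
    IsGuessingModelFor μ θ M z :=
  ⟨hel, hz, fun d hdz hd => ⟨d, h.mem_of_isApproximated hM hz hzΛ hdz hd, rfl⟩⟩

lemma guessesSubsets_inter_H (hΛ : Λ ∈ H θ) :
    GuessesSubsets μ (M ∩ H θ) Λ ↔ GuessesSubsets μ M Λ := by
  have hmem {D : ZFSet.{u}} (hD : D ⊆ Λ) : D ∈ M ∩ H θ ↔ D ∈ M := by
    rw [ZFSet.mem_inter, and_iff_left (mem_H_of_subset hΛ hD)]
  refine forall₂_congr fun D hD => imp_congr (forall_congr' fun y => ?_) (hmem hD)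
  constructor <;> intro h hy hyμ
  · exact (hmem fun _ ha => hyμ.1 (ZFSet.mem_inter.1 ha).2).1 (h ((hmem hyμ.1).2 hy) hyμ)
  · exact (hmem fun _ ha => hyμ.1 (ZFSet.mem_inter.1 ha).2).2 (h ((hmem hyμ.1).1 hy) hyμ)

lemma isStationary_guessing_iff_frequently (hκ : κ.IsRegular) (hκ₀ : ℵ₀ < κ) (hκθ : κ ≤ θ)
    (hΛ : Λ ∈ H κ) :
    IsStationary κ (H θ) {M | M ∈ Pk κ (H θ) ∧ IsElementarySub M (H θ) ∧
        ∀ z ∈ M, z.card = Λ.card → IsGuessingModelFor μ θ M z} ↔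
      ∃ᶠ M in clubFilter κ (H κ), GuessesSubsets μ M Λ := by
  rw [isStationary_iff_frequently hκ hκ₀ (Set.sep_subset _ _),
    ← map_inter_clubFilter hκ hκ₀ (H_mono hκθ), frequently_map]
  refine frequently_congr ?_
  filter_upwards [eventually_mem_Pk hκ hκ₀, eventually_isEnumClosed hκ hκ₀ hκθ hΛ,
    eventually_isElementarySub hκ hκ₀ ⟨Λ, H_mono hκθ hΛ⟩] with M hM henum hel
  rw [guessesSubsets_inter_H hΛ]
  exact ⟨fun h => (h.2.2 Λ henum.mem rfl).guessesSubsets henum,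
    fun h => ⟨hM, hel, fun z hz hzΛ => h.isGuessingModelFor henum hel hz hzΛ.le⟩⟩

lemma GMP_iff_frequently (hκ : κ.IsRegular) (hκ₀ : ℵ₀ < κ) (hΛ : Λ ∈ H κ)
    (hΛκ : κ ≤ Order.succ Λ.card) :
    GMP μ κ κ ↔ ∃ᶠ M in clubFilter κ (H κ), GuessesSubsets μ M Λ := by
  rw [GMP, isStationary_iff_frequently hκ hκ₀ (Set.sep_subset _ _)]
  refine frequently_congr ?_
  filter_upwards [eventually_mem_Pk hκ hκ₀, eventually_isEnumClosed hκ hκ₀ le_rfl hΛ,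
    eventually_isElementarySub hκ hκ₀ ⟨Λ, hΛ⟩] with M hM henum hel
  refine ⟨fun h => (h.2.2 Λ henum.mem).guessesSubsets henum, fun h => ⟨hM, hel, fun z hz => ?_⟩⟩
  exact h.isGuessingModelFor henum hel hz
    (Order.lt_succ_iff.1 ((card_lt_of_mem_H (hM.1 hz)).trans_le hΛκ))

end GuessesSubsets

section SlenderTreeProperty

variable {μ κ : Cardinal.{u}} {Λ M b : ZFSet.{u}} {D : ZFSet.{u} → ZFSet.{u}}

lemma exists_subset_notMem (h : M.card < 2 ^ Λ.card) : ∃ D ⊆ Λ, D ∉ M := by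
  by_contra! hcontains
  have hsub : Λ.powerset ⊆ M := fun D hD => hcontains D (ZFSet.mem_powerset.1 hD)
  exact (ZFSet.card_mono hsub).not_gt (by rwa [ZFSet.card_powerset])

lemma exists_subset_notMem_of_not_guessesSubsets (μ : Cardinal.{u}) (h : M.card < 2 ^ Λ.card) :
    ∃ D ⊆ Λ, D ∉ M ∧ (¬ GuessesSubsets μ M Λ → ∀ y ∈ M, y ∈ Pk μ Λ → D ∩ y ∈ M) := by
  by_cases hM : GuessesSubsets μ M Λ
  · obtain ⟨D, hD, hDM⟩ := exists_subset_notMem h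
    exact ⟨D, hD, hDM, absurd hM⟩
  · simp only [GuessesSubsets, not_forall] at hM
    obtain ⟨D, hD, htraces, hDM⟩ := hM
    exact ⟨D, hD, hDM, fun _ => htraces⟩

lemma isSlender_inter_self (hκ : κ.IsRegular) (hκ₀ : ℵ₀ < κ) (hΛ : Λ ∈ H κ)
    (hD : ∀ M ∈ Pk κ (H κ), D M ⊆ Λ)
    (h : ∀ᶠ M in clubFilter κ (H κ), ∀ y ∈ M, y ∈ Pk μ Λ → D M ∩ y ∈ M) :
    IsSlender μ κ (H κ) fun M => D M ∩ M := by
  refine ⟨κ, fun θ hθ => ?_⟩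
  rw [← map_inter_clubFilter hκ hκ₀ (H_mono hθ), eventually_map] at h
  obtain ⟨C, hC, hCN⟩ := (hasBasis_clubFilter_isClub hκ hκ₀).mem_iff.1
    (h.and (eventually_isEnumClosed hκ hκ₀ hθ hΛ))
  refine ⟨C, hC, fun N hN y hy hyμ => ?_⟩
  obtain ⟨htraces, henum⟩ := hCN hN
  have hyΛ : y ∩ Λ ∈ N ∩ H κ := ZFSet.mem_inter.2 ⟨henum.inter y hy Λ henum.mem,
    mem_H_of_subset hΛ fun _ ha => (ZFSet.mem_inter.1 ha).2⟩
  have htrace := htraces _ hyΛ (inter_mem_Pk hyμ.2)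
  have hDN : D (N ∩ H κ) ⊆ Λ := hD _ (inter_mem_Pk (hC.subset hN).2)
  have hΛN : Λ ⊆ N ∩ H κ := fun a ha =>
    ZFSet.mem_inter.2 ⟨henum.subset ha, (isTransitive_H κ).subset_of_mem hΛ ha⟩
  have heq : D (N ∩ H κ) ∩ (N ∩ H κ) ∩ y = D (N ∩ H κ) ∩ (y ∩ Λ) := by
    rw [ZFSet.inter_eq_left_of_subset (hDN.trans hΛN)]
    ext a
    simp only [ZFSet.mem_inter]
    exact ⟨fun h => ⟨h.1, h.2, hDN h.1⟩, fun h => ⟨h.1, h.2.1⟩⟩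
  exact heq ▸ (ZFSet.mem_inter.1 htrace).1

lemma IsCofinalBranch.exists_mem_self (hκ₀ : ℵ₀ < κ) (hΛ : Λ ∈ H κ)
    (hD : ∀ M ∈ Pk κ (H κ), D M ⊆ Λ) (hb : IsCofinalBranch κ (H κ) (fun M => D M ∩ M) b) :
    ∃ z ∈ Pk κ (H κ), D z ∈ z := by
  have hbΛ : b ∩ Λ ∈ H κ := mem_H_of_subset hΛ fun _ h => (ZFSet.mem_inter.1 h).2
  obtain ⟨z, hz, hxz, hbz⟩ := hb.2 (Λ ∪ {b ∩ Λ})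
    (union_mem_Pk hκ₀.le (mem_Pk_H_of_mem_H hΛ) (singleton_mem_Pk hκ₀ hbΛ))
  have hDz : b ∩ Λ = D z := by
    ext a
    have ha := ZFSet.ext_iff.1 hbz a
    have hDΛ : a ∈ D z → a ∈ Λ := fun h => hD z hz h
    have hΛz : a ∈ Λ → a ∈ z := fun h => hxz (ZFSet.mem_union.2 (.inl h))
    simp only [ZFSet.mem_inter, ZFSet.mem_union] at ha ⊢
    tauto
  exact ⟨z, hz, hDz ▸ hxz (ZFSet.mem_union.2 (.inr (ZFSet.mem_singleton.2 rfl)))⟩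

lemma SP.frequently_guessesSubsets (hκ : κ.IsRegular) (hκ₀ : ℵ₀ < κ) (hΛ : Λ ∈ H κ)
    (hΛκ : κ ≤ 2 ^ Λ.card) (hSP : SP μ κ (H κ)) :
    ∃ᶠ M in clubFilter κ (H κ), GuessesSubsets μ M Λ := by
  by_contra hnot
  choose! D hD hDmem htraces using fun M (hM : M ∈ Pk κ (H κ)) =>
    exists_subset_notMem_of_not_guessesSubsets μ (hM.2.trans_le hΛκ)
  have hslender : IsSlender μ κ (H κ) fun M => D M ∩ M := by
    refine isSlender_inter_self hκ hκ₀ hΛ hD ?_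
    filter_upwards [eventually_mem_Pk hκ hκ₀, not_frequently.1 hnot] with M hM hM'
    exact htraces M hM hM'
  have hlist : IsList κ (H κ) fun M => D M ∩ M := fun M _ a ha => (ZFSet.mem_inter.1 ha).2
  obtain ⟨b, hb⟩ := hSP _ hlist hslender
  obtain ⟨z, hz, hDz⟩ := hb.exists_mem_self hκ₀ hΛ hD
  exact hDmem z hz hDz

end SlenderTreeProperty

end SmallGuessing

open Cardinal SmallGuessing in
theorem mainTheorem12_general {μ ν κ : Cardinal.{u}} (hν : ℵ₀ ≤ ν) (hκ : Order.succ ν = κ) :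
    (SP μ κ (H κ) → GMP μ κ κ) ∧
      ∀ θ, κ ≤ θ →
        (IsStationary κ (H θ) {M | M ∈ Pk κ (H θ) ∧ IsElementarySub M (H θ) ∧
            ∀ z ∈ M, z.card = ν → IsGuessingModelFor μ θ M z} ↔
          GMP μ κ κ) := by
  have hreg : κ.IsRegular := hκ ▸ isRegular_succ hν
  have hνκ : ν < κ := hκ ▸ Order.lt_succ ν
  have hκ₀ : ℵ₀ < κ := hν.trans_lt hνκ
  have hcard : ν.ord.toZFSet.card = ν := by rw [Ordinal.card_toZFSet, card_ord]
  have hmem : ν.ord.toZFSet ∈ H κ :=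
    mem_H_of_isTransitive (ZFSet.isOrdinal_toZFSet _).isTransitive (by rwa [hcard])
  have hGMP := GMP_iff_frequently (μ := μ) hreg hκ₀ hmem (by rw [hcard, hκ])
  refine ⟨fun hSP => hGMP.2 (hSP.frequently_guessesSubsets hreg hκ₀ hmem ?_), fun θ hθ => ?_⟩
  · rw [hcard, ← hκ]
    exact Order.succ_le_of_lt (cantor ν)
  · rw [hGMP, ← isStationary_guessing_iff_frequently hreg hκ₀ hθ hmem, hcard]

/-- `SP(ω₁, ω₂, H(ω₂))` implies that for every regular `θ ≥ ω₂` there are stationarily many models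
in `𝒫_{ω₂} H(θ)` that are guessing for sets of size `ω₁`; it implies `GMP(ω₁, ω₂, H(ω₂))`; and
these two conclusions are equivalent to each other. -/
theorem mainTheorem12 :
    (SmallGuessing.SP.{u} (Cardinal.aleph 1) (Cardinal.aleph 2)
        (SmallGuessing.H (Cardinal.aleph 2)) →
      ∀ θ : Cardinal.{u}, θ.IsRegular → Cardinal.aleph 2 ≤ θ →
        SmallGuessing.IsStationary (Cardinal.aleph 2) (SmallGuessing.H θ)
          {M | M ∈ SmallGuessing.Pk (Cardinal.aleph 2) (SmallGuessing.H θ) ∧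
            SmallGuessing.IsGuessingModelForSizeOmegaOne θ M}) ∧
    (SmallGuessing.SP.{u} (Cardinal.aleph 1) (Cardinal.aleph 2)
        (SmallGuessing.H (Cardinal.aleph 2)) →
      SmallGuessing.GMP.{u} (Cardinal.aleph 1) (Cardinal.aleph 2) (Cardinal.aleph 2)) ∧
    (SmallGuessing.StationarilyManySmallGuessingModels.{u} ↔
      SmallGuessing.GMP.{u} (Cardinal.aleph 1) (Cardinal.aleph 2) (Cardinal.aleph 2)) := by
  have hsucc : Order.succ (Cardinal.aleph 1) = Cardinal.aleph.{u} 2 := by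
    rw [Cardinal.succ_aleph, one_add_one_eq_two]
  have hreg : (Cardinal.aleph.{u} 2).IsRegular :=
    hsucc ▸ Cardinal.isRegular_succ (Cardinal.aleph0_le_aleph 1)
  obtain ⟨hSP, hGMP⟩ := mainTheorem12_general (Cardinal.aleph0_le_aleph 1) hsucc
  exact ⟨fun h θ _ hθ => (hGMP θ hθ).2 (hSP h), hSP,
    fun h => (hGMP _ le_rfl).1 (h _ hreg le_rfl), fun h θ _ hθ => (hGMP θ hθ).2 h⟩
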